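/- Let $H=\sum_{j=1}^m H_j$ ($m\ge 1$) be a sum of Hermitian matrices on a finite-dimensional complex Hilbert space, let $t\ge 0$, and let $k\ge 1$. Let $S_{2k}$ be the symmetric Suzuki–Trotter formula $$S_2(x)=e^{-iH_1x/2}\cdots e^{-iH_mx/2}\,e^{-iH_mx/2}\cdots e^{-iH_1x/2},\qquad S_{2k}(x)=S_{2k-2}(u_kx)^2\,S_{2k-2}((1-4u_k)x)\,S_{2k-2}(u_kx)^2\quad(k\ge2),$$ with $u_k=(4-4^{1/(2k-1)})^{-1}$. Put $\tilde U_s(t)=S_{2k}(st)^{1/s}=\exp\!\big(\tfrac1s\log S_{2k}(st)\big)$ for real $s\neq0$, where $\log$ is the power series about the identity, and $\tilde U_0(t)=e^{-iHt}$. For a nonzero Hermitian matrix $O$ let $O_s(t)=\tilde U_s(t)^\dagger\,O\,\tilde U_s(t)$. Let $\|\cdot\|$ be the spectral norm and $$c=k\,(5/3)^k\,m\,\max_{l}\|H_l\|\,t .$$ Let $n\ge1$ be an integer and $a>0$ with $ca\le\pi/20$. For a density matrix $\rho$ let $f(s)=\mathrm{Tr}(\rho\,O_s(t))/\|O\|$,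 let $P_{n-1}f$ be the polynomial of degree at most $n-1$ that interpolates $f$ at the Chebyshev nodes $s_i=a\cos\!\big(\tfrac{2i-1}{2n}\pi\big)$, $i=1,\dots,n$, and let $E_{n-1}(0)=f(0)-P_{n-1}f(0)$. Then $s\mapsto O_s(t)$ is smooth at every point of $[-a,a]$, and: 1. If $c>n$, then for all $s\in(0,a]$ $$\frac{\|\partial_s^nO_s(t)\|}{\|O\|}<\Big(c\sqrt{e^3\big(1+\sqrt{8/\pi}\,e^2\big)}\Big)^{2n},$$ and, for every density matrix $\rho$, $\ |E_{n-1}(0)|<\Big(129\,\dfrac{c^2a}{n}\Big)^n.$ 2. If $c\le n$, then for all $s\in(0,a]$ $$\frac{\|\partial_s^nO_s(t)\|}{\|O\|}\le\sqrt{\frac{2n}{\pi}}\Big(\frac{e^4c}{2}\Big)^n n!\;e^{4ce^2\sqrt{2/\pi}},$$ and, for every density matrix $\rho$, $\ |E_{n-1}(0)|\le 2\sqrt2\,n\,(6ca)^n e^{24c}.$ -/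

import Mathlib

open scoped Matrix.Norms.L2Operator ComplexOrder ContDiff

noncomputable section

namespace TrotterInterp

variable {ι : Type*} [Fintype ι] [DecidableEq ι]

/-- The second-order symmetric product formula
`e^{-i H₁ t/2} ⋯ e^{-i H_m t/2} e^{-i H_m t/2} ⋯ e^{-i H₁ t/2}`. -/
def strang {m : ℕ} (H : Fin m → Matrix ι ι ℂ) (t : ℝ) : Matrix ι ι ℂ :=
  (List.ofFn fun j => NormedSpace.exp ((-Complex.I * (t / 2 : ℂ)) • H j)).prod *
    (List.ofFn fun j => NormedSpace.exp ((-Complex.I * (t / 2 : ℂ)) • H j)).reverse.prod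

/-- The Suzuki coefficient `u_k = (4 - 4^{1/(2k-1)})⁻¹`. -/
def suzukiCoeff (k : ℕ) : ℝ := (4 - (4 : ℝ) ^ (1 / (2 * (k : ℝ) - 1)))⁻¹

/-- The symmetric Suzuki-Trotter formula `S_{2k}` of order `2k`, for `k ≥ 1`
(the value at `k = 0` is a placeholder). -/
def suzuki {m : ℕ} (H : Fin m → Matrix ι ι ℂ) : ℕ → ℝ → Matrix ι ι ℂ
  | 0 => fun _ => 1
  | 1 => fun t => strang H t
  | k + 2 => fun t =>
      suzuki H (k + 1) (suzukiCoeff (k + 2) * t) ^ 2 *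
        suzuki H (k + 1) ((1 - 4 * suzukiCoeff (k + 2)) * t) *
        suzuki H (k + 1) (suzukiCoeff (k + 2) * t) ^ 2

/-- The logarithm of a matrix, as the power series about the identity (it converges
for `‖A - 1‖ < 1`). -/
def matLog (A : Matrix ι ι ℂ) : Matrix ι ι ℂ :=
  ∑' j : ℕ, ((-1 : ℂ) ^ j / ((j : ℂ) + 1)) • (A - 1) ^ (j + 1)

/-- The Trotterized evolution `Ũ_s(t) = S_{2k}(st)^{1/s} = exp ((1/s) log S_{2k}(st))` for
`s ≠ 0`, completed by the exact evolution `Ũ_0(t) = e^{-i H t}`, where `H = ∑ j, H j`. -/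
def trotterEvol {m : ℕ} (H : Fin m → Matrix ι ι ℂ) (k : ℕ) (t s : ℝ) : Matrix ι ι ℂ :=
  if s = 0 then NormedSpace.exp ((-Complex.I * (t : ℂ)) • ∑ j, H j)
  else NormedSpace.exp ((1 / (s : ℂ)) • matLog (suzuki H k (s * t)))

/-- The Trotterized observable `O_s(t) = Ũ_s(t)† O Ũ_s(t)`. -/
def trotterObs {m : ℕ} (H : Fin m → Matrix ι ι ℂ) (k : ℕ) (O : Matrix ι ι ℂ) (t s : ℝ) :
    Matrix ι ι ℂ :=
  (trotterEvol H k t s).conjTranspose * O * trotterEvol H k t s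

/-- The normalized expectation value `f(s) = Tr (ρ O_s(t)) / ‖O‖`. The trace is real for
Hermitian `ρ` and `O` (see `ofReal_expVal`), so taking the real part only fixes the type. -/
def expVal {m : ℕ} (H : Fin m → Matrix ι ι ℂ) (k : ℕ) (O ρ : Matrix ι ι ℂ) (t s : ℝ) : ℝ :=
  (ρ * trotterObs H k O t s).trace.re / ‖O‖

theorem ofReal_expVal {m : ℕ} (H : Fin m → Matrix ι ι ℂ) (k : ℕ) (O ρ : Matrix ι ι ℂ)
    (hO : O.IsHermitian) (hρ : ρ.IsHermitian) (t s : ℝ) :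
    ((expVal H k O ρ t s : ℝ) : ℂ) = (ρ * trotterObs H k O t s).trace / (‖O‖ : ℂ) := by
  have hA : (trotterObs H k O t s).conjTranspose = trotterObs H k O t s :=
    Matrix.isHermitian_conjTranspose_mul_mul _ hO
  have h : (starRingEnd ℂ) (ρ * trotterObs H k O t s).trace
      = (ρ * trotterObs H k O t s).trace := by
    rw [starRingEnd_apply, ← Matrix.trace_conjTranspose, Matrix.conjTranspose_mul, hA, hρ.eq,
      Matrix.trace_mul_comm]
  unfold expVal
  rw [Complex.ofReal_div, Complex.conj_eq_iff_re.mp h]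

/-- The parameter `c = k (5/3)^k m (max_l ‖H_l‖) t`. -/
def cParam {m : ℕ} (H : Fin m → Matrix ι ι ℂ) (k : ℕ) (t : ℝ) : ℝ :=
  (k : ℝ) * (5 / 3) ^ k * (m : ℝ) * (⨆ l, ‖H l‖) * t

/-- The `n` Chebyshev nodes `a cos ((2i-1)π/(2n))`, `i = 1, …, n`, on `[-a, a]`
(here `i` is shifted to start at `0`). -/
def chebNode (a : ℝ) (n : ℕ) (i : Fin n) : ℝ :=
  a * Real.cos ((2 * ((i : ℝ) + 1) - 1) / (2 * n) * Real.pi)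

/-- The error `E_{n-1}(x) = f x - (P_{n-1} f) x`, where `P_{n-1} f` is the polynomial of degree
less than `n` that interpolates `f` at the `n` Chebyshev nodes on `[-a, a]`. -/
def interpError (f : ℝ → ℝ) (a : ℝ) (n : ℕ) (x : ℝ) : ℝ :=
  f x - (Lagrange.interpolate Finset.univ (chebNode a n)
    (fun i => f (chebNode a n i))).eval x

end TrotterInterp

end

/-!
The observable is the restriction to the real axis of a holomorphic function, and everything follows
from Cauchy's estimate for that function.

The product formula `S(z)` is entire in the time `z`, unitary for real `z`, equal to the identity at
`z = 0`, and satisfies `‖S(z) - 1‖ ≤ exp (b ‖z‖) - 1`, where `b` is the sum of the norms of all the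
generators weighted with the absolute values of the time steps (`IsEvolution`). For the Suzuki
recursion each level multiplies `b` by `8 u_k - 1`, which Bernoulli's inequality bounds by
`5 / 3 * k / (k - 1)`; hence `b t ≤ 3 / 5 * c` (`isEvolution_suzukiC`).

For `‖z‖ < 1 / (2 c)` the power series of the logarithm therefore converges, and
`W(z) = z⁻¹ log S(z t)` extends holomorphically over `z = 0`, where it takes the value
`-i t ∑ j, H j` (`effGenerator`). The Schwarz lemma gives `‖W(z)‖ ≤ 3 c / 2`, and, applied once more
about a real point `s` with `|s| c < 1 / 6`, `‖W(z) - W(s)‖ ≤ 12 c ^ 2 ‖z - s‖`. For real `s` the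
matrix `W(s)` is skew-adjoint (`star_matLog`), so `exp (-W(z)) O exp (W(z))` extends `O_s(t)`.

Cauchy's estimate is used on two circles about `s`.
* On radius `1 / (4 c)`, `‖exp (± W(z))‖ ≤ exp (3 c / 2)`; this gives the bound for `c ≤ n`.
* On radius `n / (24 c ^ 2)`, Grönwall's inequality gives the better bound
  `‖exp (± W(z))‖ ≤ exp ‖W(z) - W(s)‖ ≤ exp (n / 2)` (`norm_exp_add_le`), because `W(s)` generates a
  unitary group; this gives the bound for `c > n`.

The interpolation error at `0` is at most `sup |f^(n)| / n!` times the product of the distances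
from `0` to the nodes (`abs_sub_interpolate_le`). That product is bounded by `a ^ n`, which is already
enough for the constants claimed.
-/

noncomputable section

namespace TrotterInterp

open Set Metric Filter Topology

variable {ι : Type*} [Fintype ι] [DecidableEq ι]

/-! ### Logarithm and exponential of matrices -/

theorem norm_matLog_term_le {A : Matrix ι ι ℂ} {q : ℝ} (h : ‖A - 1‖ ≤ q) (j : ℕ) :
    ‖((-1 : ℂ) ^ j / ((j : ℂ) + 1)) • (A - 1) ^ (j + 1)‖ ≤ q ^ (j + 1) := by
  rw [norm_smul]
  have h1 : ‖(-1 : ℂ) ^ j / ((j : ℂ) + 1)‖ ≤ 1 := by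
    rw [norm_div, norm_pow, norm_neg, norm_one, one_pow]
    have : ‖(j : ℂ) + 1‖ = (j : ℝ) + 1 := by
      rw [← Nat.cast_succ, Complex.norm_natCast, Nat.cast_succ]
    rw [this]
    exact div_le_one_of_le₀ (by linarith [(Nat.cast_nonneg j : (0 : ℝ) ≤ j)]) (by positivity)
  have h2 : ‖(A - 1) ^ (j + 1)‖ ≤ q ^ (j + 1) :=
    (norm_pow_le' _ j.succ_pos).trans (pow_le_pow_left₀ (norm_nonneg _) h _)
  calc _ ≤ 1 * q ^ (j + 1) := mul_le_mul h1 h2 (norm_nonneg _) zero_le_one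
    _ = _ := one_mul _

theorem hasSum_geometric_shift {q : ℝ} (h0 : 0 ≤ q) (h1 : q < 1) (i : ℕ) :
    HasSum (fun j : ℕ => q ^ (j + i)) (q ^ i / (1 - q)) := by
  simpa [pow_add, mul_comm, div_eq_mul_inv] using!
    (hasSum_geometric_of_lt_one h0 h1).mul_left (q ^ i)

theorem norm_matLog_le {A : Matrix ι ι ℂ} {q : ℝ} (h : ‖A - 1‖ ≤ q) (hq : q < 1) :
    ‖matLog A‖ ≤ q / (1 - q) := by
  have := hasSum_geometric_shift ((norm_nonneg _).trans h) hq 1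
  rw [pow_one] at this
  exact tsum_of_norm_bounded this (norm_matLog_term_le h)

theorem matLog_one : matLog (1 : Matrix ι ι ℂ) = 0 := by
  simp [matLog]

theorem norm_matLog_sub_le {A : Matrix ι ι ℂ} (h : ‖A - 1‖ ≤ 1 / 2) :
    ‖matLog A - (A - 1)‖ ≤ 2 * ‖A - 1‖ ^ 2 := by
  have hlt : ‖A - 1‖ < 1 := by linarith
  have hs : Summable fun j : ℕ => ((-1 : ℂ) ^ j / ((j : ℂ) + 1)) • (A - 1) ^ (j + 1) :=
    Summable.of_norm_bounded (hasSum_geometric_shift (norm_nonneg _) hlt 1).summable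
      (norm_matLog_term_le le_rfl)
  have e : matLog A - (A - 1)
      = ∑' j : ℕ, ((-1 : ℂ) ^ (j + 1) / (((j + 1 : ℕ) : ℂ) + 1)) • (A - 1) ^ (j + 1 + 1) := by
    rw [matLog, hs.tsum_eq_zero_add]
    simp
  rw [e]
  refine (tsum_of_norm_bounded (hasSum_geometric_shift (norm_nonneg _) hlt 2)
    fun j => norm_matLog_term_le le_rfl (j + 1)).trans ?_
  rw [div_le_iff₀ (by linarith)]
  nlinarith [sq_nonneg ‖A - 1‖]

/-- The logarithm is the identity to first order at the identity matrix. -/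
theorem hasDerivAt_matLog_comp {S : ℂ → Matrix ι ι ℂ} {S' : Matrix ι ι ℂ} {z : ℂ}
    (h : HasDerivAt S S' z) (h1 : S z = 1) : HasDerivAt (fun w => matLog (S w)) S' z := by
  have hlog : HasFDerivAt (fun A : Matrix ι ι ℂ => matLog A - (A - 1))
      (0 : Matrix ι ι ℂ →L[ℂ] Matrix ι ι ℂ) (S z) := by
    rw [h1]
    refine Asymptotics.IsBigO.hasFDerivAt (n := 2) ?_ one_lt_two
    refine Asymptotics.IsBigO.of_bound 2 ?_
    filter_upwards [closedBall_mem_nhds (1 : Matrix ι ι ℂ) (half_pos one_pos)] with A hA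
    rw [norm_pow, norm_norm]
    exact norm_matLog_sub_le (by simpa [dist_eq_norm] using hA)
  have hd : HasDerivAt (fun w => matLog (S w) - (S w - 1)) 0 z := hlog.comp_hasDerivAt z h
  have := hd.add (h.sub_const 1)
  rw [zero_add] at this
  exact this.congr_of_eventuallyEq (Eventually.of_forall fun w => by simp)

theorem differentiableOn_matLog {S : ℂ → Matrix ι ι ℂ} {U : Set ℂ} (hU : IsOpen U)
    (hS : DifferentiableOn ℂ S U) {q : ℝ} (hq : q < 1) (h : ∀ z ∈ U, ‖S z - 1‖ ≤ q) :
    DifferentiableOn ℂ (fun z => matLog (S z)) U := by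
  rcases U.eq_empty_or_nonempty with rfl | ⟨z, hz⟩
  · exact differentiableOn_empty
  refine Complex.differentiableOn_tsum_of_summable_norm
    (hasSum_geometric_shift ((norm_nonneg _).trans (h z hz)) hq 1).summable (fun j => ?_) hU
    fun j w hw => norm_matLog_term_le (h w hw) j
  exact DifferentiableOn.const_smul ((hS.sub_const 1).pow _) ((-1 : ℂ) ^ j / ((j : ℂ) + 1))

/-- The logarithm of a unitary matrix is skew-adjoint. By the continuous functional calculus the
claim reduces to the fact that the scalar logarithm is imaginary on the unit circle. -/
theorem star_matLog {A : Matrix ι ι ℂ} (hA : A ∈ unitary (Matrix ι ι ℂ)) (h : ‖A - 1‖ < 1) :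
    star (matLog A) = -matLog A := by
  have hn : IsStarNormal A := ⟨by
    rw [commute_iff_eq, (Unitary.mem_iff.mp hA).1, (Unitary.mem_iff.mp hA).2]⟩
  set φ := cfcHom (R := ℂ) (a := A) hn with hφ
  set x : C(spectrum ℂ A, ℂ) := (ContinuousMap.id ℂ).restrict (spectrum ℂ A) with hx
  have hxA : φ x = A := cfcHom_id hn
  have hsp : ∀ w : spectrum ℂ A, ‖(w : ℂ)‖ = 1 := fun w =>
    mem_sphere_zero_iff_norm.mp (spectrum.subset_circle_of_unitary hA w.2)
  have hx1 : ‖x - 1‖ < 1 := by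
    have := norm_cfcHom (𝕜 := ℂ) A (x - 1) hn
    rw [← this, map_sub, map_one]
    change ‖φ x - 1‖ < 1
    rwa [hxA]
  set L : C(spectrum ℂ A, ℂ) := ∑' j : ℕ, ((-1 : ℂ) ^ j / ((j : ℂ) + 1)) • (x - 1) ^ (j + 1)
    with hL
  have hs : Summable fun j : ℕ => ((-1 : ℂ) ^ j / ((j : ℂ) + 1)) • (x - 1) ^ (j + 1) := by
    refine Summable.of_norm_bounded (hasSum_geometric_shift (norm_nonneg _) hx1 1).summable
      fun j => ?_
    rw [norm_smul]
    have h1 : ‖(-1 : ℂ) ^ j / ((j : ℂ) + 1)‖ ≤ 1 := by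
      rw [norm_div, norm_pow, norm_neg, norm_one, one_pow, ← Nat.cast_succ, Complex.norm_natCast]
      exact div_le_one_of_le₀ (by simp) (by positivity)
    calc _ ≤ 1 * ‖x - 1‖ ^ (j + 1) :=
          mul_le_mul h1 (norm_pow_le' _ j.succ_pos) (norm_nonneg _) zero_le_one
      _ = _ := one_mul _
  have hLA : matLog A = φ L := by
    have := hs.hasSum.map φ (cfcHom_continuous hn)
    rw [matLog, ← this.tsum_eq]
    refine tsum_congr fun j => ?_
    simp only [Function.comp_apply, map_smul, map_pow, map_sub, map_one, hxA]
  have hstar : star L = -L := by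
    ext w
    have hw1 : ‖(w : ℂ) - 1‖ < 1 := lt_of_le_of_lt
      (by simpa [hx] using! (x - 1).norm_coe_le_norm w) hx1
    have hev : L w = Complex.log w := by
      have h1 := ContinuousMap.hasSum_apply hs.hasSum w
      have h2 := (hasSum_nat_add_iff' 1).mpr (Complex.hasSum_taylorSeries_log hw1)
      rw [add_sub_cancel, Finset.sum_range_one] at h2
      simp only [Nat.cast_zero, div_zero, sub_zero] at h2
      refine h1.unique (h2.congr_fun fun j => ?_)
      simp only [hx, ContinuousMap.smul_apply, ContinuousMap.pow_apply, ContinuousMap.sub_apply,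
        ContinuousMap.restrict_apply, ContinuousMap.id_apply, ContinuousMap.one_apply,
        smul_eq_mul, Nat.cast_add, Nat.cast_one]
      ring
    rw [ContinuousMap.star_apply, ContinuousMap.neg_apply, hev]
    apply Complex.ext
    · simp [Complex.log_re, hsp w]
    · simp
  rw [hLA, ← map_star, hstar, map_neg]

theorem exp_mem_unitary {A : Matrix ι ι ℂ} (hA : star A = -A) :
    NormedSpace.exp A ∈ unitary (Matrix ι ι ℂ) := by
  have e : star (NormedSpace.exp A) = NormedSpace.exp (-A) := by
    rw [← hA, Matrix.star_eq_conjTranspose, Matrix.star_eq_conjTranspose, Matrix.exp_conjTranspose]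
  have hc : Commute (-A) A := (Commute.refl A).neg_left
  rw [Unitary.mem_iff, e, ← Matrix.exp_add_of_commute _ _ hc,
    ← Matrix.exp_add_of_commute _ _ hc.symm, neg_add_cancel, add_neg_cancel, NormedSpace.exp_zero]
  exact ⟨rfl, rfl⟩

/-- A perturbation of the generator of a contraction semigroup lets the exponential grow only
through the perturbation. This is Grönwall's inequality in the interaction picture. -/
theorem norm_exp_add_le_of_forall_norm_exp_le_one {𝔸 : Type*} [NormedRing 𝔸] [NormedAlgebra ℝ 𝔸]
    [CompleteSpace 𝔸] [NormOneClass 𝔸] {A B : 𝔸} (hu : ∀ τ : ℝ, ‖NormedSpace.exp (τ • A)‖ ≤ 1) :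
    ‖NormedSpace.exp (A + B)‖ ≤ Real.exp ‖B‖ := by
  let _ : NormedAlgebra ℚ 𝔸 := NormedAlgebra.restrictScalars ℚ ℝ 𝔸
  set f : ℝ → 𝔸 := fun τ => NormedSpace.exp (τ • (-A)) * NormedSpace.exp (τ • (A + B)) with hf
  set f' : ℝ → 𝔸 := fun τ => NormedSpace.exp (τ • (-A)) * B * NormedSpace.exp (τ • (A + B))
    with hf'
  have hd : ∀ τ, HasDerivAt f (f' τ) τ := fun τ => by
    have := (hasDerivAt_exp_smul_const (𝕂 := ℝ) (-A) τ).mul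
      (hasDerivAt_exp_smul_const' (𝕂 := ℝ) (A + B) τ)
    convert! this using 1
    simp only [hf']
    noncomm_ring
  have hcancel : ∀ τ : ℝ, NormedSpace.exp (τ • A) * f τ = NormedSpace.exp (τ • (A + B)) :=
    fun τ => by
      have : NormedSpace.exp (τ • A) * NormedSpace.exp (τ • (-A)) = 1 := by
        rw [smul_neg, ← NormedSpace.exp_add_of_commute (Commute.refl (τ • A)).neg_right,
          add_neg_cancel, NormedSpace.exp_zero]
      rw [hf, ← mul_assoc, this, one_mul]
  have hb : ∀ τ, ‖f' τ‖ ≤ ‖B‖ * ‖f τ‖ + 0 := fun τ => by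
    have e : f' τ = NormedSpace.exp ((-τ) • A) * B * NormedSpace.exp (τ • A) * f τ := by
      rw [mul_assoc _ _ (f τ), hcancel, neg_smul, ← smul_neg]
    rw [e, add_zero]
    calc _ ≤ ‖NormedSpace.exp ((-τ) • A)‖ * ‖B‖ * ‖NormedSpace.exp (τ • A)‖ * ‖f τ‖ :=
          (norm_mul_le _ _).trans (mul_le_mul_of_nonneg_right ((norm_mul_le _ _).trans
            (mul_le_mul_of_nonneg_right (norm_mul_le _ _) (norm_nonneg _))) (norm_nonneg _))
      _ ≤ 1 * ‖B‖ * 1 * ‖f τ‖ := by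
          gcongr
          exacts [hu _, hu _]
      _ = _ := by ring
  have h := norm_le_gronwallBound_of_norm_deriv_right_le (f := f) (f' := f') (δ := 1) (K := ‖B‖)
    (ε := 0) (a := 0) (b := 1) (fun x _ => (hd x).continuousAt.continuousWithinAt)
    (fun x _ => (hd x).hasDerivWithinAt) (by simp [hf]) (fun x _ => hb x) 1 (by simp)
  rw [gronwallBound_ε0, sub_zero, mul_one, one_mul] at h
  calc ‖NormedSpace.exp (A + B)‖ = ‖NormedSpace.exp ((1 : ℝ) • A) * f 1‖ := by
        rw [hcancel, one_smul]
    _ ≤ 1 * Real.exp ‖B‖ :=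
        (norm_mul_le _ _).trans (mul_le_mul (hu 1) h (norm_nonneg _) zero_le_one)
    _ = _ := one_mul _

theorem norm_exp_le_one [Nonempty ι] {A : Matrix ι ι ℂ} (hA : star A = -A) :
    ‖NormedSpace.exp A‖ ≤ 1 :=
  (CStarRing.norm_of_mem_unitary (exp_mem_unitary hA)).le

/-- The special case of a skew-adjoint `A`, whose exponentials are unitary. -/
theorem norm_exp_add_le [Nonempty ι] {A B : Matrix ι ι ℂ} (hA : star A = -A) :
    ‖NormedSpace.exp (A + B)‖ ≤ Real.exp ‖B‖ := by
  refine norm_exp_add_le_of_forall_norm_exp_le_one fun τ => norm_exp_le_one ?_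
  rw [star_smul, hA, star_trivial, smul_neg]

open scoped Matrix InnerProductSpace in
/-- A density matrix pairs with every matrix to at most the operator norm. -/
theorem abs_re_trace_mul_le {ρ : Matrix ι ι ℂ} (hρ : ρ.PosSemidef) (h1 : ρ.trace = 1)
    (X : Matrix ι ι ℂ) : |(ρ * X).trace.re| ≤ ‖X‖ := by
  obtain ⟨B, rfl⟩ : ∃ B : Matrix ι ι ℂ, ρ = Bᴴ * B := by
    open scoped MatrixOrder in
    exact CStarAlgebra.nonneg_iff_eq_star_mul_self.mp hρ.nonneg
  set v : ι → EuclideanSpace ℂ ι := fun i => WithLp.toLp 2 fun j => star (B i j) with hv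
  have hsum : ∑ i, ‖v i‖ ^ 2 = 1 := by
    have : (∑ i, ‖v i‖ ^ 2 : ℂ) = 1 := by
      rw [← h1, Matrix.trace_mul_comm, Matrix.trace]
      refine Finset.sum_congr rfl fun i _ => ?_
      rw [← Complex.ofReal_pow, EuclideanSpace.norm_sq_eq, Matrix.diag_apply, Matrix.mul_apply]
      push_cast
      refine Finset.sum_congr rfl fun j _ => ?_
      simp [hv, ← Complex.mul_conj']
    exact_mod_cast this
  have htr : (Bᴴ * B * X).trace = ∑ i, ⟪v i, WithLp.toLp 2 (X *ᵥ (v i).ofLp)⟫_ℂ := by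
    rw [mul_assoc, Matrix.trace_mul_comm, Matrix.trace]
    refine Finset.sum_congr rfl fun i _ => ?_
    rw [Matrix.diag_apply, mul_assoc, Matrix.mul_apply, PiLp.inner_apply]
    refine Finset.sum_congr rfl fun j _ => ?_
    simp [hv, Matrix.mul_apply, Matrix.mulVec, dotProduct, mul_comm]
  refine (Complex.abs_re_le_norm _).trans ?_
  rw [htr]
  calc _ ≤ ∑ i, ‖⟪v i, WithLp.toLp 2 (X *ᵥ (v i).ofLp)⟫_ℂ‖ := norm_sum_le _ _
    _ ≤ ∑ i, ‖X‖ * ‖v i‖ ^ 2 := Finset.sum_le_sum fun i _ => by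
        refine (norm_inner_le_norm _ _).trans ?_
        have : ‖WithLp.toLp 2 (X *ᵥ (v i).ofLp)‖ ≤ ‖X‖ * ‖v i‖ := Matrix.l2_opNorm_mulVec X (v i)
        nlinarith [norm_nonneg (v i), mul_le_mul_of_nonneg_left this (norm_nonneg (v i))]
    _ = ‖X‖ := by rw [← Finset.mul_sum, hsum, mul_one]

/-! ### Interpolation error and derivatives along the real axis -/

/-- Iterated Rolle theorem: between `n + 1` zeros of `f` lies a zero of the `n`-th derivative. -/
theorem exists_iteratedDeriv_eq_zero {a b : ℝ} (n : ℕ) {f : ℝ → ℝ}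
    (hf : ∀ x ∈ Icc a b, ContDiffAt ℝ n f x) {z : Fin (n + 1) → ℝ} (hz : StrictMono z)
    (hmem : ∀ i, z i ∈ Icc a b) (h0 : ∀ i, f (z i) = 0) :
    ∃ ξ ∈ Icc a b, iteratedDeriv n f ξ = 0 := by
  induction n generalizing f with
  | zero => exact ⟨z 0, hmem 0, by simpa using h0 0⟩
  | succ n ih =>
    have hR : ∀ i : Fin (n + 1), ∃ w ∈ Ioo (z i.castSucc) (z i.succ), deriv f w = 0 := fun i =>
      exists_deriv_eq_zero (hz i.castSucc_lt_succ)
        (fun x hx => (hf x ⟨(hmem _).1.trans hx.1, hx.2.trans (hmem _).2⟩).continuousAt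
          |>.continuousWithinAt) (by rw [h0, h0])
    choose w hw hw0 using hR
    rw [iteratedDeriv_succ']
    refine ih (fun x hx => (hf x hx).derivWithin (by norm_cast)) ?_ (fun i => ?_) hw0
    · refine Fin.strictMono_iff_lt_succ.mpr fun i => ?_
      have h1 := (hw i.castSucc).2
      have h2 := (hw i.succ).1
      rw [Fin.succ_castSucc] at h1
      exact h1.trans h2
    · exact ⟨(hmem _).1.trans (hw i).1.le, (hw i).2.le.trans (hmem _).2⟩

theorem iteratedDeriv_polynomial_eval (p : Polynomial ℝ) (n : ℕ) :
    iteratedDeriv n (fun x => p.eval x) = fun x => (Polynomial.derivative^[n] p).eval x := by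
  induction n generalizing p with
  | zero => simp
  | succ n ih =>
    rw [iteratedDeriv_succ', Function.iterate_succ_apply, ← ih]
    congr 1
    ext x
    exact p.deriv

theorem iterate_derivative_nodal_univ {n : ℕ} (v : Fin n → ℝ) :
    Polynomial.derivative^[n] (Lagrange.nodal Finset.univ v) = Polynomial.C (n.factorial : ℝ) := by
  have hd : (Lagrange.nodal Finset.univ v).natDegree = n := by simp
  have h := Polynomial.natDegree_iterate_derivative (Lagrange.nodal Finset.univ v) n
  rw [hd, Nat.sub_self] at h
  have hc : (Lagrange.nodal Finset.univ v).coeff n = 1 := by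
    have := (Lagrange.nodal_monic (s := Finset.univ) (v := v)).coeff_natDegree
    rwa [hd] at this
  rw [Polynomial.eq_C_of_natDegree_le_zero h, Polynomial.coeff_iterate_derivative, zero_add,
    Nat.descFactorial_self, hc, nsmul_one]

/-- The error of Lagrange interpolation at `n` points of `[a, b]`. -/
theorem abs_sub_interpolate_le {a b M : ℝ} {n : ℕ} {f : ℝ → ℝ}
    (hf : ∀ x ∈ Icc a b, ContDiffAt ℝ n f x) (hM : ∀ x ∈ Icc a b, |iteratedDeriv n f x| ≤ M)
    {v : Fin n → ℝ} (hv : Function.Injective v) (hmem : ∀ i, v i ∈ Icc a b)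
    {x : ℝ} (hx : x ∈ Icc a b) :
    |f x - (Lagrange.interpolate Finset.univ v (fun i => f (v i))).eval x|
      ≤ M / n.factorial * ∏ i, |x - v i| := by
  have hM0 : 0 ≤ M := (abs_nonneg _).trans (hM x hx)
  set p := Lagrange.interpolate Finset.univ v (fun i => f (v i)) with hp
  have hnode : ∀ i, p.eval (v i) = f (v i) := fun i =>
    Lagrange.eval_interpolate_at_node _ hv.injOn (Finset.mem_univ i)
  by_cases hxv : ∃ i, x = v i
  · obtain ⟨i, rfl⟩ := hxv
    rw [hnode, sub_self, abs_zero]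
    positivity
  push Not at hxv
  set N := Lagrange.nodal Finset.univ v with hN
  have hNx : N.eval x ≠ 0 := Lagrange.eval_nodal_not_at_node fun i _ => hxv i
  -- the multiple of the nodal polynomial that makes `x` a further zero of the error
  set c := (f x - p.eval x) / N.eval x with hc
  set q := p + Polynomial.C c * N with hq
  have hqd : Polynomial.derivative^[n] q = Polynomial.C (c * n.factorial) := by
    have hdeg : p.degree < n := by
      have := Lagrange.degree_interpolate_lt (s := Finset.univ) (fun i => f (v i)) hv.injOn
      rwa [Finset.card_univ, Fintype.card_fin] at this
    rw [hq, iterate_map_add,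
      Polynomial.iterate_derivative_eq_zero_of_degree_lt hdeg,
      zero_add, Polynomial.iterate_derivative_C_mul, iterate_derivative_nodal_univ, Polynomial.C_mul]
  set S := insert x (Finset.univ.image v) with hS
  have hcard : S.card = n + 1 := by
    rw [hS, Finset.card_insert_of_notMem (by simpa [eq_comm] using hxv),
      Finset.card_image_of_injective _ hv, Finset.card_univ, Fintype.card_fin]
  have hSmem : ∀ y ∈ S, y ∈ Icc a b ∧ f y - q.eval y = 0 := fun y hy => by
    rcases Finset.mem_insert.mp hy with rfl | hy
    · refine ⟨hx, ?_⟩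
      rw [hq, Polynomial.eval_add, Polynomial.eval_mul, Polynomial.eval_C, hc,
        div_mul_cancel₀ _ hNx]
      ring
    · obtain ⟨i, -, rfl⟩ := Finset.mem_image.mp hy
      refine ⟨hmem i, ?_⟩
      rw [hq, Polynomial.eval_add, Polynomial.eval_mul, hnode,
        Lagrange.eval_nodal_at_node (Finset.mem_univ i)]
      ring
  have hqc : ContDiff ℝ n fun y => q.eval y := by
    simpa using q.contDiff_aeval (𝕜 := ℝ) n
  obtain ⟨ξ, hξ, h0⟩ := exists_iteratedDeriv_eq_zero n (f := f - fun y => q.eval y)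
    (fun y hy => (hf y hy).sub hqc.contDiffAt) (S.orderEmbOfFin hcard).strictMono
    (fun i => (hSmem _ (S.orderEmbOfFin_mem hcard i)).1)
    (fun i => (hSmem _ (S.orderEmbOfFin_mem hcard i)).2)
  rw [iteratedDeriv_sub (hf ξ hξ) hqc.contDiffAt, iteratedDeriv_polynomial_eval, hqd] at h0
  simp only [Polynomial.eval_C, sub_eq_zero] at h0
  have hcM : |c| ≤ M / n.factorial := by
    have hfac : (0 : ℝ) < n.factorial := by positivity
    rw [le_div_iff₀ hfac]
    calc |c| * n.factorial = |iteratedDeriv n f ξ| := by rw [h0, abs_mul, abs_of_pos hfac]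
      _ ≤ M := hM ξ hξ
  calc |f x - p.eval x| = |c| * ∏ i, |x - v i| := by
        rw [← Finset.abs_prod, ← abs_mul, ← Lagrange.eval_nodal, hc, div_mul_cancel₀ _ hNx]
    _ ≤ _ := mul_le_mul_of_nonneg_right hcM (Finset.prod_nonneg fun _ _ => abs_nonneg _)

theorem injective_chebNode {a : ℝ} (ha : 0 < a) (n : ℕ) :
    Function.Injective (chebNode a n) := by
  intro i j h
  have hn : (0 : ℝ) < n := Nat.cast_pos.mpr i.pos
  have hmem : ∀ i : Fin n, (2 * ((i : ℝ) + 1) - 1) / (2 * n) * Real.pi ∈ Icc 0 Real.pi := fun i => by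
    have h0 : (0 : ℝ) ≤ (i : ℝ) := Nat.cast_nonneg _
    have h1 : (i : ℝ) + 1 ≤ n := by exact_mod_cast i.2
    refine ⟨mul_nonneg (div_nonneg (by linarith) (by linarith)) Real.pi_pos.le, ?_⟩
    refine mul_le_of_le_one_left Real.pi_pos.le (div_le_one_of_le₀ (by linarith) (by linarith))
  have := Real.injOn_cos (hmem i) (hmem j) (mul_left_cancel₀ ha.ne' h)
  have := mul_right_cancel₀ Real.pi_ne_zero this
  rw [div_left_inj' (by positivity)] at this
  exact Fin.ext (by exact_mod_cast (by linarith : (i : ℝ) = j))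

theorem abs_chebNode_le {a : ℝ} (ha : 0 < a) {n : ℕ} (i : Fin n) : |chebNode a n i| ≤ a := by
  rw [chebNode, abs_mul, abs_of_pos ha]
  exact mul_le_of_le_one_right ha.le (Real.abs_cos_le_one _)

/-- The nodes lie in `[-a, a]`, so each contributes a factor of at most `a` to the nodal polynomial
at `0`. -/
theorem abs_interpError_zero_le {a M : ℝ} (ha : 0 < a) {n : ℕ} {f : ℝ → ℝ}
    (hf : ∀ x ∈ Icc (-a) a, ContDiffAt ℝ n f x)
    (hM : ∀ x ∈ Icc (-a) a, |iteratedDeriv n f x| ≤ M) :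
    |interpError f a n 0| ≤ M / n.factorial * a ^ n := by
  have h0 : (0 : ℝ) ∈ Icc (-a) a := ⟨by linarith, ha.le⟩
  refine (abs_sub_interpolate_le hf hM (injective_chebNode ha n)
    (fun i => abs_le.mp (abs_chebNode_le ha i)) h0).trans ?_
  refine mul_le_mul_of_nonneg_left ?_
    (div_nonneg ((abs_nonneg _).trans (hM 0 h0)) (Nat.cast_nonneg _))
  calc _ ≤ ∏ _i : Fin n, a := Finset.prod_le_prod (fun _ _ => abs_nonneg _) fun i _ => by
        rw [zero_sub, abs_neg]
        exact abs_chebNode_le ha i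
    _ = a ^ n := by simp

section Complex

variable {E : Type*} [NormedAddCommGroup E] [NormedSpace ℂ E] [CompleteSpace E]

/-- Differentiating a holomorphic function along the real axis. -/
theorem iteratedDeriv_comp_ofReal {U : Set ℂ} (hU : IsOpen U) (n : ℕ) {F : ℂ → E}
    (hF : DifferentiableOn ℂ F U) {s : ℝ} (hs : (s : ℂ) ∈ U) :
    iteratedDeriv n (fun x : ℝ => F x) s = iteratedDeriv n F s := by
  induction n generalizing F with
  | zero => simp
  | succ n ih =>
    rw [iteratedDeriv_succ', iteratedDeriv_succ', ← ih (hF.deriv hU)]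
    have : (deriv fun x : ℝ => F x) =ᶠ[𝓝 s] fun x : ℝ => deriv F x := by
      filter_upwards [(hU.preimage Complex.continuous_ofReal).mem_nhds hs] with x hx
      have h := (hF.differentiableAt (hU.mem_nhds hx)).hasDerivAt.scomp x
        Complex.ofRealCLM.hasDerivAt
      simpa [Function.comp_def] using! h.deriv
    exact this.iteratedDeriv_eq n

theorem contDiffAt_comp_ofReal {U : Set ℂ} (hU : IsOpen U) {F : ℂ → E}
    (hF : DifferentiableOn ℂ F U) {s : ℝ} (hs : (s : ℂ) ∈ U) :
    ContDiffAt ℝ ∞ (fun x : ℝ => F x) s := by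
  have h := (hF.contDiffOn (n := ∞) hU).contDiffAt (hU.mem_nhds hs)
  exact (h.restrict_scalars ℝ).comp s Complex.ofRealCLM.contDiff.contDiffAt

end Complex

/-! ### Suzuki product formulas at complex times -/

/-- A family of matrices that behaves like a product of exponentials of skew-adjoint matrices: it
is entire, unitary on the real axis, has velocity `X` at the origin, and its distance from the
identity is at most that of an exponential with generator of norm `b`. -/
structure IsEvolution (X : Matrix ι ι ℂ) (b : ℝ) (S : ℂ → Matrix ι ι ℂ) : Prop where
  differentiable : Differentiable ℂ S
  norm_sub_one_le : ∀ z, ‖S z - 1‖ ≤ Real.exp (b * ‖z‖) - 1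
  hasDerivAt : HasDerivAt S X 0
  mem_unitary : ∀ s : ℝ, S s ∈ unitary (Matrix ι ι ℂ)
  star_generator : star X = -X

namespace IsEvolution

variable {X Y : Matrix ι ι ℂ} {b c : ℝ} {S T : ℂ → Matrix ι ι ℂ}

theorem map_zero (h : IsEvolution X b S) : S 0 = 1 := by
  have := h.norm_sub_one_le 0
  rw [norm_zero, mul_zero, Real.exp_zero, sub_self] at this
  exact sub_eq_zero.mp (norm_le_zero_iff.mp this)

theorem mono (h : IsEvolution X b S) (hbc : b ≤ c) : IsEvolution X c S :=
  { h with
    norm_sub_one_le := fun z => (h.norm_sub_one_le z).trans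
      (sub_le_sub_right (Real.exp_le_exp.mpr (mul_le_mul_of_nonneg_right hbc (norm_nonneg z))) 1) }

theorem one : IsEvolution (0 : Matrix ι ι ℂ) 0 (fun _ => 1) where
  differentiable := differentiable_const _
  norm_sub_one_le z := by simp
  hasDerivAt := hasDerivAt_const _ _
  mem_unitary _ := one_mem _
  star_generator := by simp

theorem mul (hS : IsEvolution X b S) (hT : IsEvolution Y c T) :
    IsEvolution (X + Y) (b + c) (fun z => S z * T z) where
  differentiable := hS.differentiable.mul hT.differentiable
  norm_sub_one_le z := by
    have e : S z * T z - 1 = (S z - 1) * (T z - 1) + (S z - 1) + (T z - 1) := by noncomm_ring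
    have h1 := hS.norm_sub_one_le z
    have h2 := hT.norm_sub_one_le z
    have h3 : ‖(S z - 1) * (T z - 1)‖ ≤ (Real.exp (b * ‖z‖) - 1) * (Real.exp (c * ‖z‖) - 1) :=
      (norm_mul_le _ _).trans (mul_le_mul h1 h2 (norm_nonneg _) ((norm_nonneg _).trans h1))
    rw [e, add_mul, Real.exp_add]
    have := norm_add₃_le (a := (S z - 1) * (T z - 1)) (b := S z - 1) (c := T z - 1)
    linarith
  hasDerivAt := by
    simpa [hS.map_zero, hT.map_zero] using! hS.hasDerivAt.mul hT.hasDerivAt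
  mem_unitary s := mul_mem (hS.mem_unitary s) (hT.mem_unitary s)
  star_generator := by rw [star_add, hS.star_generator, hT.star_generator, neg_add]

/-- Rescaling time by a real factor `u`. For negative `u` only `|u|` enters the bound. -/
theorem comp_mul (hS : IsEvolution X b S) (u : ℝ) :
    IsEvolution (u • X) (|u| * b) (fun z => S (u * z)) where
  differentiable := hS.differentiable.comp (differentiable_id.const_mul _)
  norm_sub_one_le z := by
    have := hS.norm_sub_one_le (u * z)
    rwa [norm_mul, Complex.norm_real, Real.norm_eq_abs, ← mul_assoc, mul_comm b] at this
  hasDerivAt := by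
    have h0 : HasDerivAt S X ((u : ℂ) * 0) := by simpa using hS.hasDerivAt
    have := h0.scomp (0 : ℂ) ((hasDerivAt_id (0 : ℂ)).const_mul (u : ℂ))
    simpa [Function.comp_def] using! this
  mem_unitary s := by simpa using hS.mem_unitary (u * s)
  star_generator := by rw [star_smul, hS.star_generator, star_trivial, smul_neg]

theorem list_prod {α : Type*} {X : α → Matrix ι ι ℂ} {b : α → ℝ} {S : α → ℂ → Matrix ι ι ℂ}
    (h : ∀ j, IsEvolution (X j) (b j) (S j)) (l : List α) :
    IsEvolution (l.map X).sum (l.map b).sum (fun z => (l.map fun j => S j z).prod) := by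
  induction l with
  | nil => simpa using one
  | cons j l ih => simpa using (h j).mul ih

end IsEvolution

theorem norm_exp_sub_one_le (A : Matrix ι ι ℂ) :
    ‖NormedSpace.exp A - 1‖ ≤ Real.exp ‖A‖ - 1 := by
  have h1 := (hasSum_nat_add_iff' 1).mpr (NormedSpace.exp_series_hasSum_exp' (𝕂 := ℂ) A)
  have h2 := (hasSum_nat_add_iff' 1).mpr (NormedSpace.exp_series_hasSum_exp' (𝕂 := ℝ) ‖A‖)
  rw [← Real.exp_eq_exp_ℝ] at h2
  simp only [Finset.sum_range_one, Nat.factorial_zero, Nat.cast_one, inv_one, pow_zero,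
    one_smul] at h1 h2
  rw [← h1.tsum_eq]
  refine tsum_of_norm_bounded h2 fun j => ?_
  rw [norm_smul, norm_inv, Complex.norm_natCast, smul_eq_mul]
  exact mul_le_mul_of_nonneg_left (norm_pow_le' _ j.succ_pos) (by positivity)

theorem differentiable_exp : Differentiable ℂ (NormedSpace.exp : Matrix ι ι ℂ → Matrix ι ι ℂ) :=
  fun x => (NormedSpace.exp_analytic (𝕂 := ℂ) x).differentiableAt

theorem isEvolution_exp {A : Matrix ι ι ℂ} (hA : A.IsHermitian) :
    IsEvolution ((-Complex.I / 2) • A) (‖A‖ / 2)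
      (fun z => NormedSpace.exp ((-Complex.I * (z / 2)) • A)) := by
  have e : ∀ z : ℂ, (-Complex.I * (z / 2)) • A = z • ((-Complex.I / 2) • A) := fun z => by
    rw [smul_smul]
    congr 1
    ring
  have hs : star ((-Complex.I / 2) • A) = -((-Complex.I / 2) • A) := by
    rw [star_smul, Matrix.star_eq_conjTranspose, hA.eq, ← neg_smul]
    congr 1
    simp [neg_div]
  simp only [e]
  refine ⟨?_, fun z => ?_, ?_, fun s => ?_, hs⟩
  · exact differentiable_exp.comp (differentiable_id.smul_const _)
  · refine (norm_exp_sub_one_le _).trans_eq ?_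
    simp only [norm_smul, norm_div, norm_neg, Complex.norm_I, Complex.norm_ofNat]
    ring_nf
  · simpa using hasDerivAt_exp_smul_const (𝕂 := ℂ) ((-Complex.I / 2) • A) 0
  · refine exp_mem_unitary ?_
    rw [star_smul, hs, smul_neg]
    simp

/-- The symmetric Suzuki-Trotter formula at a complex time. -/
def suzukiC {m : ℕ} (H : Fin m → Matrix ι ι ℂ) : ℕ → ℂ → Matrix ι ι ℂ
  | 0 => fun _ => 1
  | 1 => fun z =>
      (List.ofFn fun j => NormedSpace.exp ((-Complex.I * (z / 2)) • H j)).prod *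
        (List.ofFn fun j => NormedSpace.exp ((-Complex.I * (z / 2)) • H j)).reverse.prod
  | k + 2 => fun z =>
      suzukiC H (k + 1) ((suzukiCoeff (k + 2) : ℝ) * z) ^ 2 *
        suzukiC H (k + 1) ((1 - 4 * suzukiCoeff (k + 2) : ℝ) * z) *
        suzukiC H (k + 1) ((suzukiCoeff (k + 2) : ℝ) * z) ^ 2

theorem suzukiC_ofReal {m : ℕ} (H : Fin m → Matrix ι ι ℂ) (k : ℕ) (t : ℝ) :
    suzukiC H k t = suzuki H k t := by
  induction k using Nat.strong_induction_on generalizing t with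
  | _ k ih =>
    match k with
    | 0 => rfl
    | 1 => rfl
    | k + 2 =>
      simp only [suzukiC, suzuki, ← Complex.ofReal_mul, ih (k + 1) (Nat.lt_succ_self _)]

/-- The absolute values of the five time steps in one step of Suzuki's recursion add up to at most
`5 / 3 * (k + 2) / (k + 1)`. By Bernoulli's inequality `4 ^ (1 / (2 k + 3)) ≤ 1 + 15 / (8 k + 13)`. -/
theorem suzukiCoeff_step_le (k : ℕ) :
    4 * |suzukiCoeff (k + 2)| + |1 - 4 * suzukiCoeff (k + 2)| ≤ 5 / 3 * ((k + 2) / (k + 1)) := by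
  set x : ℝ := (4 : ℝ) ^ (1 / (2 * ((k + 2 : ℕ) : ℝ) - 1)) with hx
  have hk : (0 : ℝ) ≤ k := Nat.cast_nonneg k
  have hxp : x ^ (2 * k + 3) = 4 := by
    rw [hx, ← Real.rpow_natCast, ← Real.rpow_mul (by norm_num)]
    have : 1 / (2 * ((k + 2 : ℕ) : ℝ) - 1) * ((2 * k + 3 : ℕ) : ℝ) = 1 := by
      push_cast
      have : 2 * ((k : ℝ) + 2) - 1 ≠ 0 := by linarith
      field_simp
      ring
    rw [this, Real.rpow_one]
  have hx0 : 0 ≤ x := Real.rpow_nonneg (by norm_num) _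
  have hx1 : 1 ≤ x := by
    by_contra h
    have := pow_lt_one₀ hx0 (not_le.mp h) (n := 2 * k + 3) (by omega)
    linarith
  have hxu : x ≤ 1 + 15 / (8 * k + 13) := by
    refine le_of_pow_le_pow_left₀ (n := 2 * k + 3) (by omega) (by positivity) ?_
    rw [hxp]
    refine le_trans ?_ (one_add_mul_le_pow (a := 15 / (8 * (k : ℝ) + 13)) ?_ _)
    · push_cast
      rw [← sub_le_iff_le_add', mul_div_assoc', le_div_iff₀ (by positivity)]
      linarith
    · have : (0 : ℝ) ≤ 15 / (8 * k + 13) := by positivity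
      linarith
  have h4 : 24 * (k + 1) / (8 * k + 13) ≤ 4 - x := by
    have : 24 * ((k : ℝ) + 1) / (8 * k + 13) = 3 - 15 / (8 * k + 13) := by
      field_simp
      ring
    linarith
  have hpos : 0 < 4 - x := lt_of_lt_of_le (by positivity) h4
  have hu : suzukiCoeff (k + 2) = (4 - x)⁻¹ := rfl
  have hu1 : 1 / 4 ≤ (4 - x)⁻¹ := by
    rw [one_div]
    exact inv_anti₀ hpos (by linarith)
  have hu2 : (4 - x)⁻¹ ≤ (8 * k + 13) / (24 * (k + 1)) := by
    rw [inv_le_comm₀ hpos (by positivity), inv_div]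
    exact h4
  rw [hu, abs_of_pos (inv_pos.mpr hpos), abs_of_nonpos (by linarith)]
  have : 5 / 3 * (((k : ℝ) + 2) / (k + 1)) = 8 * ((8 * k + 13) / (24 * (k + 1))) - 1 := by
    field_simp
    ring
  linarith

/-- The time steps of the Suzuki formula add up to the whole time, while their absolute values grow
with the order. -/
theorem isEvolution_suzukiC {m : ℕ} {H : Fin m → Matrix ι ι ℂ} (hH : ∀ j, (H j).IsHermitian)
    (k : ℕ) : IsEvolution ((-Complex.I) • ∑ j, H j) ((k + 1) * (5 / 3) ^ k * ∑ j, ‖H j‖)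
      (suzukiC H (k + 1)) := by
  induction k with
  | zero =>
    have h := (IsEvolution.list_prod (fun j => isEvolution_exp (hH j)) (List.finRange m)).mul
      (IsEvolution.list_prod (fun j => isEvolution_exp (hH j)) (List.finRange m).reverse)
    convert! h using 1
    · simp only [List.map_reverse, List.sum_reverse, ← List.ofFn_eq_map, List.sum_ofFn,
        ← Finset.smul_sum, ← add_smul]
      congr 1
      ring
    · simp only [List.map_reverse, List.sum_reverse, ← List.ofFn_eq_map, List.sum_ofFn,
        ← Finset.sum_div]
      push_cast
      ring
    · simp only [List.map_reverse, ← List.ofFn_eq_map]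
      rfl
  | succ k ih =>
    set u := suzukiCoeff (k + 2) with hu
    have h1 := ih.comp_mul u
    have h := ((h1.mul h1).mul (ih.comp_mul (1 - 4 * u))).mul (h1.mul h1)
    have hX : u • ((-Complex.I) • ∑ j, H j) + u • ((-Complex.I) • ∑ j, H j) +
        (1 - 4 * u) • ((-Complex.I) • ∑ j, H j) + (u • ((-Complex.I) • ∑ j, H j) +
        u • ((-Complex.I) • ∑ j, H j)) = (-Complex.I) • ∑ j, H j := by
      module
    rw [hX] at h
    have hS : (fun z => suzukiC H (k + 1) (u * z) * suzukiC H (k + 1) (u * z) *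
        suzukiC H (k + 1) ((1 - 4 * u : ℝ) * z) *
        (suzukiC H (k + 1) (u * z) * suzukiC H (k + 1) (u * z))) = suzukiC H (k + 1 + 1) := by
      funext z
      simp only [suzukiC, pow_two, hu]
    rw [hS] at h
    refine h.mono ?_
    have hB : (0 : ℝ) ≤ (k + 1) * (5 / 3) ^ k * ∑ j, ‖H j‖ := by positivity
    calc _ = (4 * |u| + |1 - 4 * u|) * ((k + 1) * (5 / 3) ^ k * ∑ j, ‖H j‖) := by ring
      _ ≤ 5 / 3 * ((k + 2) / (k + 1)) * ((k + 1) * (5 / 3) ^ k * ∑ j, ‖H j‖) :=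
          mul_le_mul_of_nonneg_right (suzukiCoeff_step_le k) hB
      _ = _ := by
          push_cast
          field_simp
          ring

/-! ### The effective generator and Cauchy's estimate -/

/-- The generator `z⁻¹ log S(z)` of the `1 / z`-th power of `S(z)`, with its removable singularity
at `z = 0` filled in by the derivative of `log S`. -/
def effGenerator (S : ℂ → Matrix ι ι ℂ) : ℂ → Matrix ι ι ℂ :=
  dslope (fun z => matLog (S z)) 0

/-- The holomorphic extension of the Trotterized observable. On the real axis `exp (-W)` is the
adjoint of `exp W`. -/
def effObs (S : ℂ → Matrix ι ι ℂ) (O : Matrix ι ι ℂ) (z : ℂ) : Matrix ι ι ℂ :=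
  NormedSpace.exp (-effGenerator S z) * O * NormedSpace.exp (effGenerator S z)

theorem closedBall_subset_ball_of_abs_mul_lt {C s r : ℝ} (hC : 0 < C) (hs : |s| * C < 1 / 6)
    (hr : r ≤ 1 / (4 * C)) : closedBall (s : ℂ) r ⊆ ball 0 (1 / (2 * C)) := by
  refine closedBall_subset_ball' ?_
  rw [dist_zero_right, Complex.norm_real, Real.norm_eq_abs]
  have h1 : |s| < 1 / (6 * C) := by
    rw [lt_div_iff₀ (by positivity)]
    linarith
  have h2 : 1 / (4 * C) + 1 / (6 * C) ≤ 1 / (2 * C) := by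
    field_simp
    norm_num
  linarith

namespace IsEvolution

variable {X : Matrix ι ι ℂ} {S : ℂ → Matrix ι ι ℂ} {C : ℝ}

theorem norm_sub_one_le_of_mem_ball (hS : IsEvolution X (3 / 5 * C) S) (hC : 0 < C) {z : ℂ}
    (hz : z ∈ ball (0 : ℂ) (1 / (2 * C))) : ‖S z - 1‖ ≤ 3 / 7 := by
  have hz' : ‖z‖ < 1 / (2 * C) := by simpa using hz
  rw [lt_div_iff₀ (by positivity)] at hz'
  refine (hS.norm_sub_one_le z).trans ?_
  have h1 : Real.exp (3 / 5 * C * ‖z‖) ≤ Real.exp (3 / 10) := Real.exp_le_exp.mpr (by nlinarith)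
  -- `exp x ≤ 1 / (1 - x)`
  have h2 : Real.exp (3 / 10) ≤ 10 / 7 := by
    have h3 := Real.add_one_le_exp (-(3 / 10 : ℝ))
    have h4 : Real.exp (3 / 10) * Real.exp (-(3 / 10 : ℝ)) = 1 := by rw [← Real.exp_add]; simp
    nlinarith [Real.exp_pos (3 / 10 : ℝ)]
  linarith

theorem differentiableOn_effGenerator (hS : IsEvolution X (3 / 5 * C) S) (hC : 0 < C) :
    DifferentiableOn ℂ (effGenerator S) (ball (0 : ℂ) (1 / (2 * C))) :=
  (Complex.differentiableOn_dslope (ball_mem_nhds _ (by positivity))).mpr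
    (differentiableOn_matLog isOpen_ball hS.differentiable.differentiableOn
      (q := 3 / 7) (by norm_num) fun _ hz => hS.norm_sub_one_le_of_mem_ball hC hz)

theorem norm_effGenerator_le (hS : IsEvolution X (3 / 5 * C) S) (hC : 0 < C) {z : ℂ}
    (hz : z ∈ ball (0 : ℂ) (1 / (2 * C))) : ‖effGenerator S z‖ ≤ 3 / 2 * C := by
  have hd := differentiableOn_matLog isOpen_ball
    (hS.differentiable.differentiableOn (s := ball (0 : ℂ) (1 / (2 * C))))
    (q := 3 / 7) (by norm_num) fun _ hz => hS.norm_sub_one_le_of_mem_ball hC hz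
  refine (Complex.norm_dslope_le_div_of_mapsTo_ball (R₂ := 3 / 4) hd (fun w hw => ?_) hz).trans_eq ?_
  · rw [hS.map_zero, matLog_one, mem_closedBall_zero_iff]
    exact (norm_matLog_le (hS.norm_sub_one_le_of_mem_ball hC hw) (by norm_num)).trans
      (by norm_num)
  · field_simp
    norm_num

theorem effGenerator_zero (hS : IsEvolution X C S) : effGenerator S 0 = X := by
  rw [effGenerator, dslope_same]
  exact (hasDerivAt_matLog_comp hS.hasDerivAt hS.map_zero).deriv

theorem effGenerator_of_ne (hS : IsEvolution X C S) {z : ℂ} (hz : z ≠ 0) :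
    effGenerator S z = (1 / z) • matLog (S z) := by
  rw [effGenerator, dslope_of_ne _ hz, slope_def_module, hS.map_zero, matLog_one, sub_zero,
    sub_zero, one_div]

theorem star_effGenerator (hS : IsEvolution X (3 / 5 * C) S) (hC : 0 < C) {s : ℝ}
    (hs : (s : ℂ) ∈ ball (0 : ℂ) (1 / (2 * C))) :
    star (effGenerator S s) = -effGenerator S s := by
  rcases eq_or_ne s 0 with rfl | h0
  · rw [Complex.ofReal_zero, hS.effGenerator_zero, hS.star_generator]
  · rw [hS.effGenerator_of_ne (by exact_mod_cast h0), star_smul, star_matLog (hS.mem_unitary s)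
      ((hS.norm_sub_one_le_of_mem_ball hC hs).trans_lt (by norm_num)), smul_neg]
    simp

theorem differentiableOn_effObs (hS : IsEvolution X (3 / 5 * C) S) (hC : 0 < C)
    (O : Matrix ι ι ℂ) : DifferentiableOn ℂ (effObs S O) (ball (0 : ℂ) (1 / (2 * C))) := by
  have h := hS.differentiableOn_effGenerator hC
  exact ((differentiable_exp.comp_differentiableOn h.neg).mul_const O).mul
    (differentiable_exp.comp_differentiableOn h)

/-- Close to a real point the generator is within `12 C ^ 2 r` of a skew-adjoint matrix. -/
theorem norm_effGenerator_sub_le (hS : IsEvolution X (3 / 5 * C) S) (hC : 0 < C) {s : ℝ} {z : ℂ}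
    (hs : |s| * C < 1 / 6) (hz : ‖z - s‖ < 1 / (4 * C)) :
    ‖effGenerator S z - effGenerator S s‖ ≤ 12 * C ^ 2 * ‖z - s‖ := by
  have hsub := ball_subset_closedBall.trans (closedBall_subset_ball_of_abs_mul_lt hC hs le_rfl)
  have h4 : (0 : ℝ) < 1 / (4 * C) := by positivity
  have := Complex.dist_le_div_mul_dist_of_mapsTo_ball (R₂ := 3 * C)
    ((hS.differentiableOn_effGenerator hC).mono hsub) (fun w hw => ?_)
    (show z ∈ ball (s : ℂ) (1 / (4 * C)) by rwa [mem_ball, dist_eq_norm])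
  · rw [dist_eq_norm, dist_eq_norm] at this
    refine this.trans_eq ?_
    field_simp
    ring
  · rw [mem_closedBall, dist_eq_norm]
    have h1 := hS.norm_effGenerator_le hC (hsub hw)
    have h2 := hS.norm_effGenerator_le hC (hsub (mem_ball_self h4))
    linarith [norm_sub_le (effGenerator S w) (effGenerator S s)]

theorem norm_effObs_le [Nonempty ι] {A : Matrix ι ι ℂ} (hA : star A = -A) (O : Matrix ι ι ℂ)
    (z : ℂ) {w : ℝ} (hw : ‖effGenerator S z - A‖ ≤ w) : ‖effObs S O z‖ ≤ Real.exp (2 * w) * ‖O‖ := by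
  have h1 : ‖NormedSpace.exp (effGenerator S z)‖ ≤ Real.exp w := by
    have := norm_exp_add_le (B := effGenerator S z - A) hA
    rw [add_sub_cancel] at this
    exact this.trans (Real.exp_le_exp.mpr hw)
  have h2 : ‖NormedSpace.exp (-effGenerator S z)‖ ≤ Real.exp w := by
    have := norm_exp_add_le (A := -A) (B := -(effGenerator S z - A)) (by rw [star_neg, hA])
    rw [← neg_add, add_sub_cancel, norm_neg] at this
    exact this.trans (Real.exp_le_exp.mpr hw)
  calc _ ≤ Real.exp w * ‖O‖ * Real.exp w :=
        (norm_mul_le _ _).trans (mul_le_mul ((norm_mul_le _ _).trans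
          (mul_le_mul_of_nonneg_right h2 (norm_nonneg _))) h1 (norm_nonneg _) (by positivity))
    _ = _ := by rw [two_mul, Real.exp_add]; ring

/-- Cauchy's estimate on a circle of radius `r` about a real point. -/
theorem norm_iteratedDeriv_effObs_le (hS : IsEvolution X (3 / 5 * C) S) (hC : 0 < C)
    (O : Matrix ι ι ℂ) {s r M : ℝ} (hs : |s| * C < 1 / 6) (hr : 0 < r) (hrC : r ≤ 1 / (4 * C))
    (n : ℕ) (hM : ∀ z : ℂ, ‖z - s‖ = r → ‖effObs S O z‖ ≤ M) :
    ‖iteratedDeriv n (fun x : ℝ => effObs S O x) s‖ ≤ n.factorial * M / r ^ n := by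
  have hsub := closedBall_subset_ball_of_abs_mul_lt hC hs hrC
  have hd := hS.differentiableOn_effObs hC O
  rw [iteratedDeriv_comp_ofReal isOpen_ball n hd (hsub (mem_closedBall_self hr.le))]
  refine Complex.norm_iteratedDeriv_le_of_forall_mem_sphere_norm_le n hr
    (hd.diffContOnCl_ball hsub) fun z hz => hM z ?_
  rwa [mem_sphere, dist_eq_norm] at hz

/-- Cauchy's estimate on the circle of radius `1 / (4 C)`, where only the size of the generator is
used. -/
theorem norm_iteratedDeriv_effObs_le_exp [Nonempty ι] (hS : IsEvolution X (3 / 5 * C) S)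
    (hC : 0 < C) (O : Matrix ι ι ℂ) {s : ℝ} (hs : |s| * C < 1 / 6) (n : ℕ) :
    ‖iteratedDeriv n (fun x : ℝ => effObs S O x) s‖
      ≤ n.factorial * (4 * C) ^ n * Real.exp (3 * C) * ‖O‖ := by
  have hr : (0 : ℝ) < 1 / (4 * C) := by positivity
  refine (hS.norm_iteratedDeriv_effObs_le hC O hs hr le_rfl n
    (M := Real.exp (2 * (3 / 2 * C)) * ‖O‖) fun z hz => ?_).trans_eq ?_
  · refine norm_effObs_le (A := 0) (by simp) O z ?_
    rw [sub_zero]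
    refine hS.norm_effGenerator_le hC (closedBall_subset_ball_of_abs_mul_lt hC hs le_rfl ?_)
    rw [mem_closedBall, dist_eq_norm, hz]
  · rw [show 2 * (3 / 2 * C) = 3 * C by ring, div_pow, one_pow]
    field_simp

/-- Cauchy's estimate on the circle of radius `n / (24 C ^ 2)`, where the generator stays close to
the skew-adjoint generator at the centre. This avoids an exponential factor in `C`. -/
theorem norm_iteratedDeriv_effObs_le_sq [Nonempty ι] (hS : IsEvolution X (3 / 5 * C) S)
    (O : Matrix ι ι ℂ) {s : ℝ} (hs : |s| * C < 1 / 6) {n : ℕ} (hn : 1 ≤ n) (hnC : n < C) :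
    ‖iteratedDeriv n (fun x : ℝ => effObs S O x) s‖
      ≤ n.factorial * (24 * Real.exp 1 * C ^ 2 / n) ^ n * ‖O‖ := by
  have hn0 : (1 : ℝ) ≤ n := by exact_mod_cast hn
  have hC : 0 < C := by linarith
  obtain ⟨r, hr⟩ : ∃ r : ℝ, r = n / (24 * C ^ 2) := ⟨_, rfl⟩
  have hr0 : 0 < r := by rw [hr]; positivity
  have hrC : r < 1 / (4 * C) := by
    rw [hr, div_lt_div_iff₀ (by positivity) (by positivity)]
    nlinarith
  refine (hS.norm_iteratedDeriv_effObs_le hC O hs hr0 hrC.le n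
    (M := Real.exp (2 * (12 * C ^ 2 * r)) * ‖O‖) fun z hz => ?_).trans_eq ?_
  · have hsub := closedBall_subset_ball_of_abs_mul_lt hC hs hrC.le
    refine norm_effObs_le (hS.star_effGenerator hC (hsub (mem_closedBall_self hr0.le))) O z ?_
    rw [← hz]
    exact hS.norm_effGenerator_sub_le hC hs (hz.trans_lt hrC)
  · have e : 2 * (12 * C ^ 2 * r) = n * 1 := by
      rw [hr]
      field_simp
      norm_num
    have e' : 24 * Real.exp 1 * C ^ 2 / n = Real.exp 1 / r := by
      rw [hr]
      field_simp
    rw [e, Real.exp_nat_mul, e', div_pow]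
    ring

end IsEvolution

/-! ### Bounds for the Trotterized observable -/

theorem cParam_nonneg {m : ℕ} (H : Fin m → Matrix ι ι ℂ) (k : ℕ) {t : ℝ} (ht : 0 ≤ t) :
    0 ≤ cParam H k t := by
  have : 0 ≤ ⨆ l, ‖H l‖ := Real.iSup_nonneg fun _ => norm_nonneg _
  unfold cParam
  positivity

/-- The parameter `cParam` carries a factor `(5 / 3) ^ k` where the product formula only needs
`(5 / 3) ^ (k - 1)`; this is the origin of the constant `3 / 5`. -/
theorem isEvolution_suzukiC_mul {m : ℕ} {H : Fin m → Matrix ι ι ℂ} (hH : ∀ j, (H j).IsHermitian)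
    {k : ℕ} (hk : 1 ≤ k) {t : ℝ} (ht : 0 ≤ t) {C : ℝ} (hC : cParam H k t ≤ C) :
    IsEvolution ((-Complex.I * (t : ℂ)) • ∑ j, H j) (3 / 5 * C)
      (fun z => suzukiC H k (t * z)) := by
  obtain ⟨k, rfl⟩ := Nat.exists_eq_add_of_le' hk
  have h := (isEvolution_suzukiC hH k).comp_mul t
  have hX : t • ((-Complex.I) • ∑ j, H j) = (-Complex.I * (t : ℂ)) • ∑ j, H j := by
    rw [mul_comm, mul_smul, Complex.coe_smul]
  rw [hX] at h
  refine h.mono ?_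
  have hsum : ∑ j, ‖H j‖ ≤ m * ⨆ l, ‖H l‖ := by
    refine (Finset.sum_le_sum fun j _ =>
      le_ciSup (Set.finite_range fun l => ‖H l‖).bddAbove j).trans_eq ?_
    simp
  rw [abs_of_nonneg ht]
  calc t * ((k + 1) * (5 / 3) ^ k * ∑ j, ‖H j‖)
      ≤ t * ((k + 1) * (5 / 3) ^ k * (m * ⨆ l, ‖H l‖)) := by gcongr
    _ = 3 / 5 * cParam H (k + 1) t := by
        rw [cParam, pow_succ]
        push_cast
        ring
    _ ≤ 3 / 5 * C := by linarith

theorem trotterEvol_eq {m : ℕ} {H : Fin m → Matrix ι ι ℂ} {k : ℕ} {t b : ℝ}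
    (hS : IsEvolution ((-Complex.I * (t : ℂ)) • ∑ j, H j) b (fun z => suzukiC H k (t * z)))
    (s : ℝ) : trotterEvol H k t s
      = NormedSpace.exp (effGenerator (fun z => suzukiC H k (t * z)) s) := by
  unfold trotterEvol
  split_ifs with h
  · rw [h, Complex.ofReal_zero, hS.effGenerator_zero]
  · rw [hS.effGenerator_of_ne (by exact_mod_cast h), ← Complex.ofReal_mul, suzukiC_ofReal,
      mul_comm s]

theorem trotterObs_eq {m : ℕ} {H : Fin m → Matrix ι ι ℂ} {k : ℕ} {t C : ℝ} (hC : 0 < C)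
    (hS : IsEvolution ((-Complex.I * (t : ℂ)) • ∑ j, H j) (3 / 5 * C)
      (fun z => suzukiC H k (t * z)))
    (O : Matrix ι ι ℂ) {s : ℝ} (hs : (s : ℂ) ∈ ball (0 : ℂ) (1 / (2 * C))) :
    trotterObs H k O t s = effObs (fun z => suzukiC H k (t * z)) O s := by
  have h := hS.star_effGenerator hC hs
  rw [Matrix.star_eq_conjTranspose] at h
  rw [trotterObs, trotterEvol_eq hS, ← Matrix.exp_conjTranspose, h, effObs]

theorem trotterObs_eventuallyEq {m : ℕ} {H : Fin m → Matrix ι ι ℂ} {k : ℕ} {t C : ℝ} (hC : 0 < C)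
    (hS : IsEvolution ((-Complex.I * (t : ℂ)) • ∑ j, H j) (3 / 5 * C)
      (fun z => suzukiC H k (t * z)))
    (O : Matrix ι ι ℂ) {s : ℝ} (hs : |s| * C < 1 / 6) :
    (fun x => trotterObs H k O t x) =ᶠ[𝓝 s]
      fun x : ℝ => effObs (fun z => suzukiC H k (t * z)) O x := by
  have hmem : (s : ℂ) ∈ ball (0 : ℂ) (1 / (2 * C)) :=
    closedBall_subset_ball_of_abs_mul_lt hC hs le_rfl (mem_closedBall_self (by positivity))
  filter_upwards [(isOpen_ball.preimage Complex.continuous_ofReal).mem_nhds hmem] with x hx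
  exact trotterObs_eq hC hS O hx

theorem eventually_nhdsGT_mul_lt {c s : ℝ} (hs : |s| * c < 1 / 6) :
    ∀ᶠ C in 𝓝[>] c, |s| * C < 1 / 6 :=
  ((continuous_const.mul continuous_id).tendsto c).eventually_lt_const hs |>.filter_mono
    nhdsWithin_le_nhds

theorem contDiffAt_trotterObs {m : ℕ} {H : Fin m → Matrix ι ι ℂ} (hH : ∀ j, (H j).IsHermitian)
    {k : ℕ} (hk : 1 ≤ k) {t : ℝ} (ht : 0 ≤ t) (O : Matrix ι ι ℂ) {s : ℝ}
    (hs : |s| * cParam H k t < 1 / 6) :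
    ContDiffAt ℝ ∞ (fun s => trotterObs H k O t s) s := by
  obtain ⟨C, hsC, hcC⟩ := ((eventually_nhdsGT_mul_lt hs).and self_mem_nhdsWithin).exists
  have hC : 0 < C := (cParam_nonneg H k ht).trans_lt hcC
  have hS := isEvolution_suzukiC_mul hH hk ht (le_of_lt hcC)
  exact (contDiffAt_comp_ofReal isOpen_ball (hS.differentiableOn_effObs hC O)
    (closedBall_subset_ball_of_abs_mul_lt hC hsC le_rfl (mem_closedBall_self (by positivity)))
    ).congr_of_eventuallyEq (trotterObs_eventuallyEq hC hS O hsC)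

theorem norm_iteratedDeriv_trotterObs_le_exp [Nonempty ι] {m : ℕ} {H : Fin m → Matrix ι ι ℂ}
    (hH : ∀ j, (H j).IsHermitian) {k : ℕ} (hk : 1 ≤ k) {t : ℝ} (ht : 0 ≤ t) (O : Matrix ι ι ℂ)
    {s : ℝ} (hs : |s| * cParam H k t < 1 / 6) (n : ℕ) :
    ‖iteratedDeriv n (fun s => trotterObs H k O t s) s‖
      ≤ n.factorial * (4 * cParam H k t) ^ n * Real.exp (3 * cParam H k t) * ‖O‖ := by
  -- the estimate needs a positive parameter; the case `cParam H k t = 0` follows by continuity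
  have hlim : Tendsto (fun C : ℝ => n.factorial * (4 * C) ^ n * Real.exp (3 * C) * ‖O‖)
      (𝓝[>] (cParam H k t)) (𝓝 (n.factorial * (4 * cParam H k t) ^ n *
        Real.exp (3 * cParam H k t) * ‖O‖)) :=
    (Continuous.tendsto (by fun_prop) _).mono_left nhdsWithin_le_nhds
  refine ge_of_tendsto hlim ?_
  filter_upwards [eventually_nhdsGT_mul_lt hs, self_mem_nhdsWithin] with C hsC hcC
  have hC : 0 < C := (cParam_nonneg H k ht).trans_lt hcC
  have hS := isEvolution_suzukiC_mul hH hk ht (le_of_lt hcC)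
  rw [(trotterObs_eventuallyEq hC hS O hsC).iteratedDeriv_eq n]
  exact hS.norm_iteratedDeriv_effObs_le_exp hC O hsC n

theorem norm_iteratedDeriv_trotterObs_le_sq [Nonempty ι] {m : ℕ} {H : Fin m → Matrix ι ι ℂ}
    (hH : ∀ j, (H j).IsHermitian) {k : ℕ} (hk : 1 ≤ k) {t : ℝ} (ht : 0 ≤ t) (O : Matrix ι ι ℂ)
    {s : ℝ} (hs : |s| * cParam H k t < 1 / 6) {n : ℕ} (hn : 1 ≤ n) (hnc : n < cParam H k t) :
    ‖iteratedDeriv n (fun s => trotterObs H k O t s) s‖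
      ≤ n.factorial * (24 * Real.exp 1 * cParam H k t ^ 2 / n) ^ n * ‖O‖ := by
  have hC : 0 < cParam H k t := (Nat.cast_nonneg n).trans_lt hnc
  have hS := isEvolution_suzukiC_mul hH hk ht le_rfl
  rw [(trotterObs_eventuallyEq hC hS O hs).iteratedDeriv_eq n]
  exact hS.norm_iteratedDeriv_effObs_le_sq O hs hn hnc

/-- Interpolation error of the expectation value in terms of the derivatives of the observable. -/
theorem abs_interpError_expVal_le {m : ℕ} {H : Fin m → Matrix ι ι ℂ} {k : ℕ} {t : ℝ}
    {O ρ : Matrix ι ι ℂ} (hρ : ρ.PosSemidef) (hρ1 : ρ.trace = 1) {a M : ℝ} (ha : 0 < a) {n : ℕ}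
    (hd : ∀ s ∈ Icc (-a) a, ContDiffAt ℝ ∞ (fun s => trotterObs H k O t s) s)
    (hM : ∀ s ∈ Icc (-a) a, ‖iteratedDeriv n (fun s => trotterObs H k O t s) s‖ ≤
      n.factorial * M * ‖O‖) (hM0 : 0 ≤ M) :
    |interpError (expVal H k O ρ t) a n 0| ≤ M * a ^ n := by
  let L₀ : Matrix ι ι ℂ →ₗ[ℝ] ℝ :=
    { toFun := fun X => (ρ * X).trace.re / ‖O‖
      map_add' := fun X Y => by rw [mul_add, Matrix.trace_add, Complex.add_re, add_div]
      map_smul' := fun r X => by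
        rw [Matrix.mul_smul, Matrix.trace_smul, Complex.smul_re, RingHom.id_apply, smul_eq_mul,
          smul_eq_mul, mul_div_assoc] }
  have hL₀ : ∀ X, ‖L₀ X‖ ≤ ‖O‖⁻¹ * ‖X‖ := fun X => by
    change |(ρ * X).trace.re / ‖O‖| ≤ _
    rw [abs_div, abs_norm, div_eq_inv_mul]
    exact mul_le_mul_of_nonneg_left (abs_re_trace_mul_le hρ hρ1 X) (inv_nonneg.mpr (norm_nonneg _))
  let L := L₀.mkContinuous _ hL₀
  have hf : expVal H k O ρ t = L ∘ fun s => trotterObs H k O t s := rfl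
  have hn : (n : WithTop ℕ∞) ≤ ∞ := by exact_mod_cast le_top
  have hfac : (n.factorial : ℝ) ≠ 0 := by positivity
  have h := abs_interpError_zero_le (f := expVal H k O ρ t) (M := n.factorial * M) ha
    (fun s hs => ?_) (n := n) fun s hs => ?_
  · rwa [mul_div_cancel_left₀ _ hfac] at h
  · rw [hf]
    exact (L.contDiff.contDiffAt.comp s (hd s hs)).of_le hn
  · rw [hf, ← Real.norm_eq_abs, ← norm_iteratedFDeriv_eq_norm_iteratedDeriv]
    refine (L.norm_iteratedFDeriv_comp_left (hd s hs) hn).trans ?_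
    rw [norm_iteratedFDeriv_eq_norm_iteratedDeriv]
    have hL : ‖L‖ ≤ ‖O‖⁻¹ := L₀.mkContinuous_norm_le (inv_nonneg.mpr (norm_nonneg _)) hL₀
    calc _ ≤ ‖O‖⁻¹ * (n.factorial * M * ‖O‖) :=
          mul_le_mul hL (hM s hs) (norm_nonneg _) (inv_nonneg.mpr (norm_nonneg _))
      _ = n.factorial * M * (‖O‖⁻¹ * ‖O‖) := by ring
      _ ≤ n.factorial * M * 1 := mul_le_mul_of_nonneg_left inv_mul_le_one (by positivity)
      _ = _ := mul_one _

end TrotterInterp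

end

theorem lemma8 {ι : Type*} [Fintype ι] [DecidableEq ι]
    {m : ℕ} (hm : 0 < m) (H : Fin m → Matrix ι ι ℂ) (hH : ∀ j, (H j).IsHermitian)
    (k : ℕ) (hk : 1 ≤ k) (t : ℝ) (ht : 0 ≤ t)
    (O : Matrix ι ι ℂ) (hO : O.IsHermitian) (hO0 : O ≠ 0)
    (n : ℕ) (hn : 1 ≤ n) (a : ℝ) (ha : 0 < a)
    (hca : TrotterInterp.cParam H k t * a ≤ Real.pi / 20) :
    (∀ s ∈ Set.Icc (-a) a, ContDiffAt ℝ ∞ (fun s => TrotterInterp.trotterObs H k O t s) s) ∧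
    ((n : ℝ) < TrotterInterp.cParam H k t →
      (∀ s ∈ Set.Ioc 0 a,
        ‖iteratedDeriv n (fun s => TrotterInterp.trotterObs H k O t s) s‖ / ‖O‖ <
          (TrotterInterp.cParam H k t *
            √(Real.exp 3 * (1 + √(8 / Real.pi) * Real.exp 2))) ^ (2 * n)) ∧
      (∀ ρ : Matrix ι ι ℂ, ρ.PosSemidef → ρ.trace = 1 →
        |TrotterInterp.interpError (TrotterInterp.expVal H k O ρ t) a n 0| <
          (129 * (TrotterInterp.cParam H k t ^ 2 * a / n)) ^ n)) ∧
    (TrotterInterp.cParam H k t ≤ (n : ℝ) →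
      (∀ s ∈ Set.Ioc 0 a,
        ‖iteratedDeriv n (fun s => TrotterInterp.trotterObs H k O t s) s‖ / ‖O‖ ≤
          √(2 * n / Real.pi) * (Real.exp 4 * TrotterInterp.cParam H k t / 2) ^ n *
            (n.factorial : ℝ) *
            Real.exp (4 * TrotterInterp.cParam H k t * Real.exp 2 * √(2 / Real.pi))) ∧
      (∀ ρ : Matrix ι ι ℂ, ρ.PosSemidef → ρ.trace = 1 →
        |TrotterInterp.interpError (TrotterInterp.expVal H k O ρ t) a n 0| ≤
          2 * √2 * n * (6 * TrotterInterp.cParam H k t * a) ^ n *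
            Real.exp (24 * TrotterInterp.cParam H k t))) := by
  set c := TrotterInterp.cParam H k t with hc
  have hc0 : 0 ≤ c := TrotterInterp.cParam_nonneg H k ht
  have hO' : 0 < ‖O‖ := norm_pos_iff.mpr hO0
  have : Nonempty ι := by
    by_contra h
    rw [not_nonempty_iff] at h
    exact hO0 (Subsingleton.elim _ _)
  have hn0 : (1 : ℝ) ≤ n := by exact_mod_cast hn
  -- `c a ≤ π / 20 < 1 / 6`
  have hsc : ∀ s ∈ Set.Icc (-a) a, |s| * c < 1 / 6 := fun s hs => by
    have h1 : |s| * c ≤ a * c := mul_le_mul_of_nonneg_right (abs_le.mpr hs) hc0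
    linarith [Real.pi_lt_d2]
  have hsub : ∀ s ∈ Set.Ioc 0 a, s ∈ Set.Icc (-a) a := fun s hs => ⟨by linarith [hs.1], hs.2⟩
  have hd : ∀ s ∈ Set.Icc (-a) a,
      ContDiffAt ℝ ∞ (fun s => TrotterInterp.trotterObs H k O t s) s := fun s hs =>
    TrotterInterp.contDiffAt_trotterObs hH hk ht O (hsc s hs)
  refine ⟨hd, fun hnc => ?_, fun _ => ?_⟩
  · have hcpos : 0 < c := by linarith
    have hM : ∀ s ∈ Set.Icc (-a) a,
        ‖iteratedDeriv n (fun s => TrotterInterp.trotterObs H k O t s) s‖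
          ≤ n.factorial * (24 * Real.exp 1 * c ^ 2 / n) ^ n * ‖O‖ := fun s hs =>
      TrotterInterp.norm_iteratedDeriv_trotterObs_le_sq hH hk ht O (hsc s hs) hn hnc
    have he : 24 * Real.exp 1 < 66 := by linarith [Real.exp_one_lt_d9]
    refine ⟨fun s hs => ?_, fun ρ hρ hρ1 => ?_⟩
    · rw [div_lt_iff₀ hO']
      refine (hM s (hsub s hs)).trans_lt (mul_lt_mul_of_pos_right ?_ hO')
      have hbig : 66 ≤ Real.exp 3 * (1 + √(8 / Real.pi) * Real.exp 2) := by
        have h3 : 8 ≤ Real.exp 3 := by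
          have : Real.exp 3 = Real.exp 1 ^ 3 := by rw [← Real.exp_nat_mul]; norm_num
          rw [this]
          calc (8 : ℝ) = 2 ^ 3 := by norm_num
            _ ≤ _ := pow_le_pow_left₀ (by norm_num) (by linarith [Real.exp_one_gt_d9]) 3
        have h2 : 7.25 ≤ Real.exp 2 := by
          have : Real.exp 2 = Real.exp 1 ^ 2 := by rw [← Real.exp_nat_mul]; norm_num
          rw [this]
          nlinarith [Real.exp_one_gt_d9]
        have h1 : 1 ≤ √(8 / Real.pi) := by
          rw [Real.one_le_sqrt, le_div_iff₀ Real.pi_pos]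
          linarith [Real.pi_lt_d2]
        nlinarith [mul_le_mul h1 h2 (by norm_num) (by linarith)]
      calc (n.factorial : ℝ) * (24 * Real.exp 1 * c ^ 2 / n) ^ n
          ≤ (n : ℝ) ^ n * (24 * Real.exp 1 * c ^ 2 / n) ^ n := by
            refine mul_le_mul_of_nonneg_right ?_ (by positivity)
            exact_mod_cast Nat.factorial_le_pow n
        _ = (24 * Real.exp 1 * c ^ 2) ^ n := by
            rw [← mul_pow, mul_div_cancel₀ _ (by linarith)]
        _ < (66 * c ^ 2) ^ n :=
            pow_lt_pow_left₀ (mul_lt_mul_of_pos_right he (by positivity)) (by positivity) (by omega)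
        _ ≤ (Real.exp 3 * (1 + √(8 / Real.pi) * Real.exp 2) * c ^ 2) ^ n := by gcongr
        _ = _ := by
            rw [pow_mul, mul_pow c, Real.sq_sqrt (by positivity), mul_comm]
    · refine (TrotterInterp.abs_interpError_expVal_le hρ hρ1 ha hd hM (by positivity)).trans_lt ?_
      rw [← mul_pow]
      refine pow_lt_pow_left₀ ?_ (by positivity) (by omega)
      have : 0 < c ^ 2 * a / n := by positivity
      calc 24 * Real.exp 1 * c ^ 2 / n * a = 24 * Real.exp 1 * (c ^ 2 * a / n) := by ring
        _ < 129 * (c ^ 2 * a / n) := mul_lt_mul_of_pos_right (by linarith) this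
  · have hM : ∀ s ∈ Set.Icc (-a) a,
        ‖iteratedDeriv n (fun s => TrotterInterp.trotterObs H k O t s) s‖
          ≤ n.factorial * ((4 * c) ^ n * Real.exp (3 * c)) * ‖O‖ := fun s hs => by
      rw [← mul_assoc]
      exact TrotterInterp.norm_iteratedDeriv_trotterObs_le_exp hH hk ht O (hsc s hs) n
    refine ⟨fun s hs => ?_, fun ρ hρ hρ1 => ?_⟩
    · rw [div_le_iff₀ hO']
      refine (hM s (hsub s hs)).trans (mul_le_mul_of_nonneg_right ?_ hO'.le)
      have h1 : 1 / 2 ≤ √(2 * n / Real.pi) := by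
        refine Real.le_sqrt_of_sq_le ?_
        rw [le_div_iff₀ Real.pi_pos]
        linarith [Real.pi_lt_d2]
      have h2 : 2 * (4 * c) ^ n ≤ (Real.exp 4 * c / 2) ^ n := by
        have h4 : 16 ≤ Real.exp 4 := by
          have : Real.exp 4 = Real.exp 1 ^ 4 := by rw [← Real.exp_nat_mul]; norm_num
          rw [this]
          calc (16 : ℝ) = 2 ^ 4 := by norm_num
            _ ≤ _ := pow_le_pow_left₀ (by norm_num) (by linarith [Real.exp_one_gt_d9]) 4
        calc 2 * (4 * c) ^ n ≤ 2 ^ n * (4 * c) ^ n := by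
              refine mul_le_mul_of_nonneg_right ?_ (by positivity)
              calc (2 : ℝ) = 2 ^ 1 := (pow_one _).symm
                _ ≤ 2 ^ n := pow_le_pow_right₀ (by norm_num) hn
          _ = (8 * c) ^ n := by rw [← mul_pow]; ring
          _ ≤ _ := pow_le_pow_left₀ (by positivity) (by nlinarith) n
      have h3 : Real.exp (3 * c) ≤ Real.exp (4 * c * Real.exp 2 * √(2 / Real.pi)) := by
        refine Real.exp_le_exp.mpr ?_
        have h5 : 3 ≤ Real.exp 2 := by linarith [Real.add_one_le_exp (2 : ℝ)]
        have h6 : 1 / 2 ≤ √(2 / Real.pi) := by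
          refine Real.le_sqrt_of_sq_le ?_
          rw [le_div_iff₀ Real.pi_pos]
          linarith [Real.pi_lt_d2]
        nlinarith [mul_le_mul h5 h6 (by norm_num) (by linarith)]
      calc (n.factorial : ℝ) * ((4 * c) ^ n * Real.exp (3 * c))
          = 1 / 2 * (2 * (4 * c) ^ n) * n.factorial * Real.exp (3 * c) := by ring
        _ ≤ _ := by gcongr
    · refine (TrotterInterp.abs_interpError_expVal_le hρ hρ1 ha hd hM (by positivity)).trans ?_
      have h1 : 1 ≤ 2 * √2 * n := by
        have : 1 ≤ √2 := by rw [Real.one_le_sqrt]; norm_num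
        nlinarith
      calc (4 * c) ^ n * Real.exp (3 * c) * a ^ n
          = 1 * (4 * c * a) ^ n * Real.exp (3 * c) := by rw [mul_pow _ a]; ring
        _ ≤ _ := by
          gcongr <;> linarith
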